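/- \textbf{Definitions.} Let $\Sigma_n$ be the symmetric group on $n$ letters ($n\ge 0$) and let $\Sigma=\{\Sigma_n\}$ be the operad of symmetric groups: $\mu(\sigma;\tau_1,\dots,\tau_n)\in\Sigma_{k_1+\cdots+k_n}$ permutes the elements inside the $i$-th block (of size $k_i$) by $\tau_i$ and then moves the $i$-th block, as a block, to the $\sigma(i)$-th place. An \emph{action operad} $\mathbf{\Lambda}$ consists of a (nonsymmetric, unital) operad $\Lambda=\{\Lambda(n)\}_{n\ge 0}$ in the category of sets, with multiplication $\mu$, a group structure on each $\Lambda(n)$, and a map of operads $\pi:\Lambda\to\Sigma$ such that each $\pi_n:\Lambda(n)\to\Sigma_n$ is a group homomorphism, subject to the axiom \[ \mu(g;f_1,\dots,f_n)\,\mu(g';f_1',\dots,f_n')=\mu\big(gg';f_{\pi(g')(1)}f_1',\dots,f_{\pi(g')(n)}f_n'\big) \] in $\Lambda(k_1+\cdots+k_n)$, for all $g,g'\in\Lambda(n)$, $f_i'\in\Lambda(k_i)$ and $f_i\in\Lambda(k_{\pi(g')^{-1}(i)})$. The category $\mathbf{AOp}$ has action operads as objects, and its morphisms $\mathbf{\Lambda}\to\mathbf{\Lambda}'$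 are the operad maps $f:\Lambda\to\Lambda'$ such that each $f_n$ is a group homomorphism and $\pi'_n\circ f_n=\pi_n$. Let $\mathbb{S}=\coprod_{n\ge 0}\Sigma_n$ (a set), and let $\mathbf{Sets}/\mathbb{S}$ be the slice category of sets over $\mathbb{S}$ (\emph{collections over} $\mathbb{S}$). The forgetful functor $U:\mathbf{AOp}\to\mathbf{Sets}/\mathbb{S}$ sends $\mathbf{\Lambda}$ to $\coprod_n\Lambda(n)\to\mathbb{S}$, the map induced by the $\pi_n$. A category is \emph{locally finitely presentable} if it is cocomplete and has a small set of finitely presentable objects (objects $x$ such that $\mathrm{Hom}(x,-)$ preserves filtered colimits) such that every object is a filtered colimit of a diagram of objects from this set. \textbf{Theorem.} \begin{enumerate} \item The category $\mathbf{AOp}$ is locally finitely presentable. \item The functor $U:\mathbf{AOp}\to\mathbf{Sets}/\mathbb{S}$ preserves all (small) limits and all (small) filtered colimits. \item $U$ has a left adjoint $F:\mathbf{Sets}/\mathbb{S}\to\mathbf{AOp}$, the free action operad functor. \end{enumerate} -/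

import Mathlib

open CategoryTheory CategoryTheory.Limits

universe u v w

/-- A (nonsymmetric) operad in the category of sets.  The multiplication
`μ : O(n) × O(k₁) × ⋯ × O(kₙ) → O(k₁ + ⋯ + kₙ)` is written `comp k hm`, where `hm` says
`k₁ + ⋯ + kₙ = m`, so that no transport along equalities of natural numbers is needed. -/
structure NSOperad where
  /-- The set of `n`-ary operations. -/
  obj : ℕ → Type u
  /-- The operadic unit. -/
  one : obj 1
  /-- The operadic multiplication. -/
  comp : ∀ {n m : ℕ} (k : Fin n → ℕ), ∑ i, k i = m → obj n → (∀ i, obj (k i)) → obj m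
  one_comp : ∀ {k : ℕ} (x : obj k), comp (fun _ : Fin 1 => k) (by simp) one (fun _ => x) = x
  comp_one : ∀ {n : ℕ} (x : obj n), comp (fun _ : Fin n => 1) (by simp) x (fun _ => one) = x
  /-- Associativity: the innermost operations `h i j`, `i : Fin m`, `j : Fin (n i)`, are listed
  lexicographically, i.e. indexed by `Fin (∑ i, n i)` through the bijection `finSigmaFinEquiv`. -/
  assoc : ∀ {m M : ℕ} (n : Fin m → ℕ) (p : Fin (∑ i, n i) → ℕ) (hM : ∑ l, p l = M)
    (hM' : ∑ i, ∑ j, p (finSigmaFinEquiv ⟨i, j⟩) = M)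
    (f : obj m) (g : ∀ i, obj (n i)) (h : ∀ l, obj (p l)),
    comp (fun i => ∑ j, p (finSigmaFinEquiv ⟨i, j⟩)) hM' f
        (fun i => comp (fun j => p (finSigmaFinEquiv ⟨i, j⟩)) rfl (g i)
          (fun j => h (finSigmaFinEquiv ⟨i, j⟩))) =
      comp p hM (comp n rfl f g) h

/-- Maps of operads. -/
@[ext]
structure NSOperad.Hom (O : NSOperad.{u}) (P : NSOperad.{v}) where
  /-- The underlying functions. -/
  app : ∀ n, O.obj n → P.obj n
  map_one : app 1 O.one = P.one
  map_comp : ∀ {n m : ℕ} (k : Fin n → ℕ) (hm : ∑ i, k i = m) (x : O.obj n)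
    (y : ∀ i, O.obj (k i)),
    app m (O.comp k hm x y) = P.comp k hm (app n x) (fun i => app (k i) (y i))

/-- The identity map of an operad. -/
def NSOperad.Hom.id (O : NSOperad.{u}) : NSOperad.Hom O O where
  app _ x := x
  map_one := rfl
  map_comp _ _ _ _ := rfl

/-- Composition of maps of operads. -/
def NSOperad.Hom.trans {O : NSOperad.{u}} {P : NSOperad.{v}} {Q : NSOperad.{w}}
    (a : NSOperad.Hom O P) (b : NSOperad.Hom P Q) : NSOperad.Hom O Q where
  app n x := b.app n (a.app n x)
  map_one := by rw [a.map_one, b.map_one]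
  map_comp k hm x y := by rw [a.map_comp, b.map_comp]

namespace SymmOperad

/-- The bijection cutting `{1, …, m}` into consecutive blocks of sizes `k₁, …, kₙ`:
the pair `⟨i, j⟩` is the `j`-th element of the `i`-th block. -/
def block {n m : ℕ} (k : Fin n → ℕ) (hm : ∑ i, k i = m) : (Σ i : Fin n, Fin (k i)) ≃ Fin m :=
  finSigmaFinEquiv.trans (finCongr hm)

/-- Operadic multiplication of permutations: `τ i` acts inside the `i`-th block (of size `k i`),
and then the `i`-th block is moved, as a block, to the `σ i`-th place.  In the target, the `j`-th
block therefore has size `k (σ⁻¹ j)`. -/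
def comp {n m : ℕ} (k : Fin n → ℕ) (hm : ∑ i, k i = m) (σ : Equiv.Perm (Fin n))
    (τ : ∀ i, Equiv.Perm (Fin (k i))) : Equiv.Perm (Fin m) :=
  (block k hm).symm.trans
    ((Equiv.sigmaCongr (β₂ := fun j => Fin (k (σ.symm j))) σ
      (fun i => (τ i).trans (finCongr (by rw [Equiv.symm_apply_apply])))).trans
    (block (fun j => k (σ.symm j)) (by rw [← hm]; exact Equiv.sum_comp σ.symm k)))

theorem block_val {n m : ℕ} (k : Fin n → ℕ) (hm : ∑ i, k i = m) (i : Fin n) (j : Fin (k i)) :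
    (block k hm ⟨i, j⟩ : ℕ) = (∑ s, if s < i then k s else 0) + j := by
  have h1 : (block k hm ⟨i, j⟩ : ℕ) = ∑ s : Fin i, k (Fin.castLE i.2.le s) + j := by
    simp [block]
  rw [h1, ← Finset.sum_filter]
  congr 1
  refine Finset.sum_bij (fun s _ => Fin.castLE i.2.le s) ?_ ?_ ?_ ?_
  · intro s _
    exact Finset.mem_filter.2 ⟨Finset.mem_univ _, s.2⟩
  · intro a _ b _ hab
    exact Fin.castLE_injective _ hab
  · intro b hb
    simp only [Finset.mem_filter, Finset.mem_univ, true_and] at hb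
    exact ⟨⟨b, hb⟩, Finset.mem_univ _, rfl⟩
  · intro _ _
    rfl

theorem comp_block {n m : ℕ} (k : Fin n → ℕ) (hm : ∑ i, k i = m) (σ : Equiv.Perm (Fin n))
    (τ : ∀ i, Equiv.Perm (Fin (k i))) (i : Fin n) (j : Fin (k i)) :
    (comp k hm σ τ (block k hm ⟨i, j⟩) : ℕ) =
      (∑ s, if σ s < σ i then k s else 0) + (τ i j : ℕ) := by
  have h1 : comp k hm σ τ (block k hm ⟨i, j⟩) =
      block (fun j => k (σ.symm j)) (by rw [← hm]; exact Equiv.sum_comp σ.symm k)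
        ⟨σ i, finCongr (by rw [Equiv.symm_apply_apply]) (τ i j)⟩ := by
    simp [comp, Equiv.sigmaCongr]
  rw [h1, block_val]
  congr 1
  rw [← Equiv.sum_comp σ]
  simp

theorem block_val' {n : ℕ} (k : Fin n → ℕ) (i : Fin n) (j : Fin (k i)) :
    (finSigmaFinEquiv ⟨i, j⟩ : Fin (∑ i, k i)) = block k rfl ⟨i, j⟩ := rfl

theorem comp_block_lt {n m : ℕ} (k : Fin n → ℕ) (hm : ∑ i, k i = m) (σ : Equiv.Perm (Fin n))
    (τ : ∀ i, Equiv.Perm (Fin (k i))) (i s : Fin n) (j : Fin (k i)) (t : Fin (k s))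
    (h : σ s < σ i) :
    comp k hm σ τ (block k hm ⟨s, t⟩) < comp k hm σ τ (block k hm ⟨i, j⟩) := by
  rw [Fin.lt_def, comp_block, comp_block]
  have h2 : (∑ a, if σ a < σ s then k a else 0) + k s ≤ ∑ a, if σ a < σ i then k a else 0 := by
    have h3 : k s = ∑ a, if a = s then k a else 0 := by simp
    rw [h3, ← Finset.sum_add_distrib]
    refine Finset.sum_le_sum fun a _ => ?_
    by_cases ha : a = s
    · subst ha
      simp [h]
    · by_cases hb : σ a < σ s
      · simp [ha, hb, hb.trans h]
      · simp [ha, hb]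
  have h4 := (τ s t).2
  omega

/-- Associativity of the multiplication of permutations. -/
theorem comp_assoc {m M : ℕ} (n : Fin m → ℕ) (p : Fin (∑ i, n i) → ℕ) (hM : ∑ l, p l = M)
    (hM' : ∑ i, ∑ j, p (finSigmaFinEquiv ⟨i, j⟩) = M) (f : Equiv.Perm (Fin m))
    (g : ∀ i, Equiv.Perm (Fin (n i))) (h : ∀ l, Equiv.Perm (Fin (p l))) :
    comp (fun i => ∑ j, p (finSigmaFinEquiv ⟨i, j⟩)) hM' f
        (fun i => comp (fun j => p (finSigmaFinEquiv ⟨i, j⟩)) rfl (g i)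
          (fun j => h (finSigmaFinEquiv ⟨i, j⟩))) =
      comp p hM (comp n rfl f g) h := by
  have key : ∀ (f : Equiv.Perm (Fin m)) (g : ∀ i, Equiv.Perm (Fin (n i))) (i : Fin m)
      (j : Fin (n i)),
      (∑ u, if comp n rfl f g u < comp n rfl f g (finSigmaFinEquiv ⟨i, j⟩) then p u else 0) =
      (∑ s, if f s < f i then ∑ t, p (finSigmaFinEquiv ⟨s, t⟩) else 0) +
        ∑ t, if g i t < g i j then p (finSigmaFinEquiv ⟨i, t⟩) else 0 := by
    intro f g i j
    rw [← Equiv.sum_comp finSigmaFinEquiv, Fintype.sum_sigma]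
    have h3 : (∑ t, if g i t < g i j then p (finSigmaFinEquiv ⟨i, t⟩) else 0) =
        ∑ s, if s = i then
          (∑ t, if g i t < g i j then p (finSigmaFinEquiv ⟨i, t⟩) else 0) else 0 := by
      simp
    rw [h3, ← Finset.sum_add_distrib]
    refine Finset.sum_congr rfl fun s _ => ?_
    simp only [block_val']
    rcases lt_trichotomy (f s) (f i) with hs | hs | hs
    · have hne : s ≠ i := fun e => by subst e; exact lt_irrefl _ hs
      simp only [hs, if_true, hne, if_false, add_zero]
      exact Finset.sum_congr rfl fun t _ => if_pos (comp_block_lt n rfl f g i s j t hs)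
    · have e := f.injective hs
      subst e
      simp only [lt_irrefl, if_false, if_true, zero_add]
      refine Finset.sum_congr rfl fun t _ => ?_
      have : comp n rfl f g (block n rfl ⟨s, t⟩) < comp n rfl f g (block n rfl ⟨s, j⟩) ↔
          g s t < g s j := by
        rw [Fin.lt_def, comp_block, comp_block, Fin.lt_def]
        omega
      simp only [this]
    · have hne : s ≠ i := fun e => by subst e; exact lt_irrefl _ hs
      simp only [hs.not_gt, if_false, hne, add_zero]
      exact Finset.sum_eq_zero fun t _ =>
        if_neg (comp_block_lt n rfl f g s i t j hs).not_gt
  have comp_id : comp n rfl (1 : Equiv.Perm (Fin m)) (fun i => (1 : Equiv.Perm (Fin (n i)))) = 1 := by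
    ext x
    obtain ⟨⟨i, j⟩, rfl⟩ := (block n rfl).surjective x
    rw [Equiv.Perm.one_apply, comp_block, block_val]
    rfl
  ext x
  obtain ⟨⟨u, l⟩, rfl⟩ := (block p hM).surjective x
  obtain ⟨⟨i, j⟩, rfl⟩ := finSigmaFinEquiv.surjective u
  have nest : block p hM ⟨finSigmaFinEquiv ⟨i, j⟩, l⟩ =
      block (fun i => ∑ j, p (finSigmaFinEquiv ⟨i, j⟩)) hM'
        ⟨i, block (fun j => p (finSigmaFinEquiv ⟨i, j⟩)) rfl ⟨j, l⟩⟩ := by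
    apply Fin.ext
    rw [block_val, block_val, block_val]
    have := key 1 (fun i => 1) i j
    rw [comp_id] at this
    simp only [Equiv.Perm.one_apply] at this
    rw [← add_assoc]
    exact congrArg (· + (l : ℕ)) this
  rw [comp_block, key, nest, comp_block, comp_block, add_assoc]

theorem one_comp {k : ℕ} (x : Equiv.Perm (Fin k)) :
    comp (fun _ : Fin 1 => k) (by simp) 1 (fun _ => x) = x := by
  have hb : ∀ (i : Fin 1) (j : Fin k), block (fun _ : Fin 1 => k) (by simp) ⟨i, j⟩ = j := by
    intro i j
    apply Fin.ext
    rw [block_val]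
    simp
  ext y
  conv_lhs => rw [← hb 0 y]
  rw [comp_block]
  simp

theorem comp_one {n : ℕ} (x : Equiv.Perm (Fin n)) :
    comp (fun _ : Fin n => 1) (by simp) x (fun _ => 1) = x := by
  have hs : ∀ i : Fin n, (∑ s, if s < i then 1 else 0) = (i : ℕ) := by
    intro i
    rw [← Finset.sum_filter, ← Finset.card_eq_sum_ones, Finset.filter_gt_eq_Iio]
    simp
  have hb : ∀ i : Fin n, block (fun _ : Fin n => 1) (by simp) ⟨i, 0⟩ = i := by
    intro i
    apply Fin.ext
    rw [block_val, hs]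
    simp
  ext y
  conv_lhs => rw [← hb y]
  rw [comp_block]
  have := hs (x y)
  rw [← Equiv.sum_comp x] at this
  simp [this]

end SymmOperad

/-- The operad `Σ` of symmetric groups. -/
def SymmOperad : NSOperad.{0} where
  obj n := Equiv.Perm (Fin n)
  one := 1
  comp := SymmOperad.comp
  one_comp := SymmOperad.one_comp
  comp_one := SymmOperad.comp_one
  assoc := SymmOperad.comp_assoc

/-- For a map of operads `π : O → Σ`, the permutation `π(x)` of an operation `x ∈ O(n)`. -/
def NSOperad.Hom.toPerm {O : NSOperad.{u}} (π : NSOperad.Hom O SymmOperad) {n : ℕ} (x : O.obj n) :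
    Equiv.Perm (Fin n) :=
  π.app n x

/-- Action operads. -/
structure ActionOperad extends NSOperad.{u} where
  /-- The group structure on the set of `n`-ary operations. -/
  [group : ∀ n, Group (obj n)]
  /-- The map of operads `π` to the operad of symmetric groups. -/
  π : NSOperad.Hom toNSOperad SymmOperad
  π_mul : ∀ {n : ℕ} (g g' : obj n), π.toPerm (g * g') = π.toPerm g * π.toPerm g'
  /-- The action operad axiom
  `μ(g; f₁, …, fₙ) μ(g'; f'₁, …, f'ₙ) = μ(g g'; f_{π(g')(1)} f'₁, …, f_{π(g')(n)} f'ₙ)`.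
  Here `f i ∈ Λ(k i)` and `f' i ∈ Λ(k (π(g') i))`, which are exactly the tuples for which the
  products make sense; equivalently, `f' i ∈ Λ(k' i)` and `f i ∈ Λ(k' (π(g')⁻¹ i))`, where
  `k' = k ∘ π(g')`. -/
  comp_mul_comp : ∀ {n m : ℕ} (g g' : obj n) (k : Fin n → ℕ) (hm : ∑ i, k i = m)
    (hm' : ∑ i, k (π.toPerm g' i) = m)
    (f : ∀ i, obj (k i)) (f' : ∀ i, obj (k (π.toPerm g' i))),
    comp k hm g f * comp (fun i => k (π.toPerm g' i)) hm' g' f' =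
      comp (fun i => k (π.toPerm g' i)) hm' (g * g') (fun i => f (π.toPerm g' i) * f' i)

namespace ActionOperad

attribute [instance] ActionOperad.group

/-- Maps of action operads: maps of operads which are levelwise group homomorphisms and preserve
underlying permutations. -/
@[ext]
structure Hom (L M : ActionOperad.{u}) extends NSOperad.Hom L.toNSOperad M.toNSOperad where
  map_mul : ∀ {n : ℕ} (g h : L.obj n), app n (g * h) = app n g * app n h
  toPerm_app : ∀ {n : ℕ} (g : L.obj n), M.π.toPerm (app n g) = L.π.toPerm g

/-- The category of action operads. -/
instance : LargeCategory ActionOperad.{u} where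
  Hom := Hom
  id L :=
    { NSOperad.Hom.id L.toNSOperad with
      map_mul := fun _ _ => rfl
      toPerm_app := fun _ => rfl }
  comp a b :=
    { a.toHom.trans b.toHom with
      map_mul := fun g h => by
        simp only [NSOperad.Hom.trans, a.map_mul, b.map_mul]
      toPerm_app := fun g => by
        simp only [NSOperad.Hom.trans, a.toPerm_app, b.toPerm_app] }

end ActionOperad

/-- The set `𝕊`: the disjoint union of the underlying sets of all the symmetric groups, as an
object of the category of sets in the universe `u`. -/
def SymmSet : Type u := ULift.{u} (Σ n : ℕ, Equiv.Perm (Fin n))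

/-- The category `Sets/𝕊` of collections over `𝕊`. -/
abbrev SymmCollection : Type (u + 1) := Over SymmSet.{u}

/-- The forgetful functor from action operads to collections over `𝕊`: it sends `Λ` to the disjoint
union of the sets `Λ(n)`, with each element mapped to its underlying permutation. -/
def ActionOperad.forget : ActionOperad.{u} ⥤ SymmCollection.{u} where
  obj L := Over.mk (Y := Σ n, L.obj n)
    (TypeCat.ofHom fun x => (ULift.up ⟨x.1, L.π.toPerm x.2⟩ : SymmSet.{u}))
  map {L M} a := Over.homMk (TypeCat.ofHom fun x => ⟨x.1, a.app x.1 x.2⟩) (by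
    ext x
    exact congrArg (fun t => (ULift.up ⟨x.1, t⟩ : SymmSet.{u})) (a.toPerm_app x.2))

/-!
Action operads are the models of a finitary equational theory whose sorts are the elements of `𝕊`:
an operation over `σ` has sort `σ`, and each operation of the structure takes finitely many
arguments, with the sort of its value determined by the sorts of the arguments.  The three
assertions follow from this as they do for every such theory.

*Generators and relations.*  `ActionOperad.Term X n` is the set of formal expressions of arity `n`
in a family of generators.  Two expressions are identified when they take the same value in every
action operad in which the generators are interpreted over their prescribed permutations and
satisfy the imposed relations.  All laws then hold for the classes because they hold in every model,
and the resulting action operad `Presentation.presented` classifies models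
(`Presentation.lift`, `Presentation.presented_hom_ext`).  The symmetric groups form a model of every
presentation (`Presentation.symmModel`), which makes the underlying permutation of a class well
defined.  Without relations this is the left adjoint `freeFunctor` of the forgetful functor, which
therefore preserves limits; the presentation by all operations of the members of a diagram, with the
relations which hold in every cocone, gives the colimit of the diagram.

*Filtered colimits.*  As every operation has finitely many arguments, the filtered colimit of the
sets `F_j(n)` inherits the structure of an action operad, computed at a common stage of the diagram
(`FilteredColimit.colim`), and it is the colimit of action operads.  Colimits over `𝕊` are those of
the underlying sets, so the forgetful functor preserves filtered colimits.

*Local finite presentability.*  A one-point collection is finitely presentable, hence so is the free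
action operad on it, the forgetful functor being finitary.  Maps out of the free action operad on
one generator over `σ` are the operations over `σ`, so these action operads separate maps and detect
isomorphisms among monomorphisms: they form a strong generator.  A cocomplete category with a small
strong generator of finitely presentable objects is locally finitely presentable.
-/

/-! ### Action operads presented by generators and relations -/

/-- The action operad axiom for permutations. -/
theorem SymmOperad.comp_mul_comp {n m : ℕ} (σ σ' : Equiv.Perm (Fin n)) (k : Fin n → ℕ)
    (hm : ∑ i, k i = m) (hm' : ∑ i, k (σ' i) = m) (τ : ∀ i, Equiv.Perm (Fin (k i)))
    (τ' : ∀ i, Equiv.Perm (Fin (k (σ' i)))) :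
    comp k hm σ τ * comp (fun i => k (σ' i)) hm' σ' τ' =
      comp (fun i => k (σ' i)) hm' (σ * σ') (fun i => τ (σ' i) * τ' i) := by
  ext x
  obtain ⟨⟨i, j⟩, rfl⟩ := (block (fun i => k (σ' i)) hm').surjective x
  have h : comp (fun i => k (σ' i)) hm' σ' τ' (block (fun i => k (σ' i)) hm' ⟨i, j⟩) =
      block k hm ⟨σ' i, τ' i j⟩ := by
    apply Fin.ext
    rw [comp_block, block_val, ← Equiv.sum_comp σ' fun s => if s < σ' i then k s else 0]
  rw [Equiv.Perm.mul_apply, h, comp_block, comp_block,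
    ← Equiv.sum_comp σ' fun s => if σ s < σ (σ' i) then k s else 0]
  rfl

namespace ActionOperad

/-- The action operad of symmetric groups, lifted to the universe `u`. -/
def symm : ActionOperad.{u} where
  obj n := ULift.{u} (Equiv.Perm (Fin n))
  one := ⟨1⟩
  comp k hm x y := ⟨SymmOperad.comp k hm x.down fun i => (y i).down⟩
  one_comp x := ULift.ext _ _ (SymmOperad.one_comp x.down)
  comp_one x := ULift.ext _ _ (SymmOperad.comp_one x.down)
  assoc n p hM hM' f g h := ULift.ext _ _
    (SymmOperad.comp_assoc n p hM hM' f.down (fun i => (g i).down) fun l => (h l).down)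
  π :=
    { app _ x := x.down
      map_one := rfl
      map_comp _ _ _ _ := rfl }
  π_mul _ _ := rfl
  comp_mul_comp g g' k hm hm' f f' := ULift.ext _ _
    (SymmOperad.comp_mul_comp g.down g'.down k hm hm' (fun i => (f i).down) fun i => (f' i).down)

section

variable {L M N : ActionOperad.{u}}

/-- The action operad axiom with the permutation underlying `g'` given up to equality. -/
theorem comp_mul_comp_of_eq {n m : ℕ} (g g' : L.obj n) {σ : Equiv.Perm (Fin n)}
    (hσ : L.π.toPerm g' = σ) (k : Fin n → ℕ) (hm : ∑ i, k i = m) (hm' : ∑ i, k (σ i) = m)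
    (f : ∀ i, L.obj (k i)) (f' : ∀ i, L.obj (k (σ i))) :
    L.comp k hm g f * L.comp (fun i => k (σ i)) hm' g' f' =
      L.comp (fun i => k (σ i)) hm' (g * g') (fun i => f (σ i) * f' i) := by
  subst hσ
  exact L.comp_mul_comp g g' k hm hm' f f'

theorem π_one (n : ℕ) : L.π.toPerm (1 : L.obj n) = 1 :=
  (MonoidHom.mk' (fun x : L.obj n => L.π.toPerm x) L.π_mul).map_one

theorem π_inv {n : ℕ} (g : L.obj n) : L.π.toPerm g⁻¹ = (L.π.toPerm g)⁻¹ :=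
  (MonoidHom.mk' (fun x : L.obj n => L.π.toPerm x) L.π_mul).map_inv g

theorem π_comp {n m : ℕ} (k : Fin n → ℕ) (hm : ∑ i, k i = m) (x : L.obj n)
    (y : ∀ i, L.obj (k i)) :
    L.π.toPerm (L.comp k hm x y) =
      SymmOperad.comp k hm (L.π.toPerm x) fun i => L.π.toPerm (y i) :=
  L.π.map_comp k hm x y

theorem Hom.map_group_one (a : Hom L M) (n : ℕ) : a.app n 1 = 1 :=
  (MonoidHom.mk' (fun x : L.obj n => a.app n x) a.map_mul).map_one

theorem Hom.map_inv (a : Hom L M) {n : ℕ} (g : L.obj n) : a.app n g⁻¹ = (a.app n g)⁻¹ :=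
  (MonoidHom.mk' (fun x : L.obj n => a.app n x) a.map_mul).map_inv g

theorem hom_ext {a b : L ⟶ M} (h : ∀ n (x : L.obj n), a.app n x = b.app n x) : a = b :=
  Hom.ext (funext fun n => funext (h n))

theorem comp_app (a : L ⟶ M) (b : M ⟶ N) (n : ℕ) (x : L.obj n) :
    (a ≫ b).app n x = b.app n (a.app n x) :=
  rfl

end

/-- Formal expressions in generators `x ∈ X n` of arity `n`, built with the operations of an action
operad. -/
inductive Term (X : ℕ → Type u) : ℕ → Type u
  | var {n : ℕ} (x : X n) : Term X n
  | unit : Term X 1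
  | comp {n m : ℕ} (k : Fin n → ℕ) (hm : ∑ i, k i = m) (x : Term X n)
      (y : ∀ i, Term X (k i)) : Term X m
  | one (n : ℕ) : Term X n
  | mul {n : ℕ} (x y : Term X n) : Term X n
  | inv {n : ℕ} (x : Term X n) : Term X n

namespace Term

variable {X : ℕ → Type u}

/-- The value of an expression in an action operad, for given values of the generators. -/
def eval (M : ActionOperad.{u}) (v : ∀ n, X n → M.obj n) : ∀ {n : ℕ}, Term X n → M.obj n
  | _, var x => v _ x
  | _, unit => M.one
  | _, comp k hm x y => M.comp k hm (eval M v x) fun i => eval M v (y i)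
  | _, one _ => 1
  | _, mul x y => eval M v x * eval M v y
  | _, inv x => (eval M v x)⁻¹

/-- The permutation underlying an expression, given those underlying the generators. -/
def perm (p : ∀ n, X n → Equiv.Perm (Fin n)) {n : ℕ} (t : Term X n) : Equiv.Perm (Fin n) :=
  (t.eval symm fun n x => ⟨p n x⟩).down

/-- Evaluation respects underlying permutations, as soon as the values of the generators do. -/
theorem π_eval {M : ActionOperad.{u}} {v : ∀ n, X n → M.obj n}
    {p : ∀ n, X n → Equiv.Perm (Fin n)} (hv : ∀ n x, M.π.toPerm (v n x) = p n x) {n : ℕ}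
    (t : Term X n) : M.π.toPerm (t.eval M v) = t.perm p := by
  induction t with
  | var x => exact hv _ x
  | unit => exact M.π.map_one
  | comp k hm x y hx hy =>
    rw [eval, π_comp, hx, funext hy]
    rfl
  | one n => exact π_one n
  | mul x y hx hy =>
    rw [eval, π_mul, hx, hy]
    rfl
  | inv x hx =>
    rw [eval, π_inv, hx]
    rfl

theorem eval_app {M N : ActionOperad.{u}} (a : M ⟶ N) (v : ∀ n, X n → M.obj n) {n : ℕ}
    (t : Term X n) : a.app n (t.eval M v) = t.eval N fun n x => a.app n (v n x) := by
  induction t with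
  | var x => rfl
  | unit => exact a.map_one
  | comp k hm x y hx hy => simp only [eval, a.map_comp, hx, hy]
  | one n => exact a.map_group_one n
  | mul x y hx hy => simp only [eval, a.map_mul, hx, hy]
  | inv x hx => simp only [eval, a.map_inv, hx]

end Term

/-- Generators and relations for an action operad: generators `x ∈ X n` lying over prescribed
permutations, and relations between expressions with the same underlying permutation. -/
structure Presentation where
  /-- The generators of each arity. -/
  X : ℕ → Type u
  /-- The permutations underlying the generators. -/
  p : ∀ n, X n → Equiv.Perm (Fin n)
  /-- The relations imposed. -/
  R : ∀ {n : ℕ}, Term X n → Term X n → Prop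
  perm_eq : ∀ {n : ℕ} {s t : Term X n}, R s t → s.perm p = t.perm p

namespace Presentation

variable (P : Presentation.{u})

/-- A model of a presentation in `M`: values of the generators in `M` which lie over the prescribed
permutations and satisfy the relations. -/
structure Model (M : ActionOperad.{u}) where
  /-- The values of the generators. -/
  val : ∀ n, P.X n → M.obj n
  π_val : ∀ n x, M.π.toPerm (val n x) = P.p n x
  eval_eq : ∀ {n : ℕ} {s t : Term P.X n}, P.R s t → s.eval M val = t.eval M val

/-- Two expressions are identified when they take the same value in every model.  The laws of an
action operad hold for the classes because they hold in every model. -/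
def setoid (n : ℕ) : Setoid (Term P.X n) where
  r s t := ∀ (M : ActionOperad.{u}) (v : P.Model M), s.eval M v.val = t.eval M v.val
  iseqv :=
    { refl _ _ _ := rfl
      symm h M v := (h M v).symm
      trans h h' M v := (h M v).trans (h' M v) }

/-- The classes of expressions of arity `n`. -/
def Class (n : ℕ) : Type u :=
  Quotient (P.setoid n)

variable {P}

/-- The class of an expression. -/
def cls {n : ℕ} (t : Term P.X n) : P.Class n :=
  Quotient.mk (P.setoid n) t

theorem cls_eq {n : ℕ} {s t : Term P.X n}
    (h : ∀ (M : ActionOperad.{u}) (v : P.Model M), s.eval M v.val = t.eval M v.val) :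
    cls s = cls t :=
  Quotient.sound h

theorem eval_eq_of_cls_eq {n : ℕ} {s t : Term P.X n} (h : cls s = cls t) {M : ActionOperad.{u}}
    (v : P.Model M) : s.eval M v.val = t.eval M v.val :=
  Quotient.exact h M v

theorem exists_cls {n : ℕ} (x : P.Class n) : ∃ t, x = cls t :=
  ⟨_, (Quotient.out_eq x).symm⟩

theorem exists_cls_family {ι : Type*} {k : ι → ℕ} (y : ∀ i, P.Class (k i)) :
    ∃ t : ∀ i, Term P.X (k i), y = fun i => cls (t i) :=
  ⟨_, funext fun i => (Quotient.out_eq (y i)).symm⟩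

/-- The tautological model in the symmetric groups. -/
def symmModel : P.Model symm where
  val n x := ⟨P.p n x⟩
  π_val _ _ := rfl
  eval_eq h := ULift.ext _ _ (P.perm_eq h)

/-- The operadic multiplication of classes, computed on representatives. -/
noncomputable def comp {n m : ℕ} (k : Fin n → ℕ) (hm : ∑ i, k i = m) (x : P.Class n)
    (y : ∀ i, P.Class (k i)) : P.Class m :=
  cls (.comp k hm x.out fun i => (y i).out)

theorem comp_cls {n m : ℕ} (k : Fin n → ℕ) (hm : ∑ i, k i = m) (x : Term P.X n)
    (y : ∀ i, Term P.X (k i)) : comp k hm (cls x) (fun i => cls (y i)) = cls (.comp k hm x y) := by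
  refine cls_eq fun M v => ?_
  have hx := eval_eq_of_cls_eq (Quotient.out_eq (cls x)) v
  have hy i := eval_eq_of_cls_eq (Quotient.out_eq (cls (y i))) v
  rw [Term.eval, Term.eval, hx, funext hy]

instance (n : ℕ) : Mul (P.Class n) :=
  ⟨Quotient.map₂ .mul fun _ _ h _ _ h' M v => by rw [Term.eval, Term.eval, h M v, h' M v]⟩

instance (n : ℕ) : Inv (P.Class n) :=
  ⟨Quotient.map .inv fun _ _ h M v => by rw [Term.eval, Term.eval, h M v]⟩

instance (n : ℕ) : One (P.Class n) :=
  ⟨cls (.one n)⟩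

instance classGroup (n : ℕ) : Group (P.Class n) :=
  Group.ofLeftAxioms
    (fun x y z => by
      obtain ⟨x, rfl⟩ := exists_cls x
      obtain ⟨y, rfl⟩ := exists_cls y
      obtain ⟨z, rfl⟩ := exists_cls z
      exact cls_eq fun M v => mul_assoc _ _ _)
    (fun x => by
      obtain ⟨x, rfl⟩ := exists_cls x
      exact cls_eq fun M v => one_mul _)
    (fun x => by
      obtain ⟨x, rfl⟩ := exists_cls x
      exact cls_eq fun M v => inv_mul_cancel _)

variable (P)

/-- The operad underlying the presented action operad. -/
noncomputable def operad : NSOperad.{u} where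
  obj := P.Class
  one := cls .unit
  comp := comp
  one_comp x := by
    obtain ⟨x, rfl⟩ := exists_cls x
    rw [comp_cls]
    exact cls_eq fun M v => M.one_comp _
  comp_one x := by
    obtain ⟨x, rfl⟩ := exists_cls x
    rw [comp_cls]
    exact cls_eq fun M v => M.comp_one _
  assoc n p hM hM' f g h := by
    obtain ⟨f, rfl⟩ := exists_cls f
    obtain ⟨g, rfl⟩ := exists_cls_family g
    obtain ⟨h, rfl⟩ := exists_cls_family h
    simp only [comp_cls]
    exact cls_eq fun M v => M.assoc n p hM hM' _ _ fun l => (h l).eval M v.val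

/-- The action operad with the given presentation. -/
noncomputable def presented : ActionOperad.{u} where
  toNSOperad := P.operad
  group n := classGroup n
  π :=
    { app _ := Quotient.lift (Term.perm P.p) fun _ _ h => congrArg ULift.down (h symm symmModel)
      map_one := rfl
      map_comp k hm x y := by
        obtain ⟨x, rfl⟩ := exists_cls x
        obtain ⟨y, rfl⟩ := exists_cls_family y
        refine (congrArg _ (comp_cls k hm x y)).trans ?_
        rfl }
  π_mul g g' := by
    obtain ⟨g, rfl⟩ := exists_cls g
    obtain ⟨g', rfl⟩ := exists_cls g'
    rfl
  comp_mul_comp g g' k hm hm' f f' := by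
    obtain ⟨g, rfl⟩ := exists_cls g
    obtain ⟨g', rfl⟩ := exists_cls g'
    obtain ⟨f, rfl⟩ := exists_cls_family f
    obtain ⟨f', rfl⟩ := exists_cls_family f'
    refine (congrArg₂ (· * · : P.Class _ → P.Class _ → P.Class _) (comp_cls k hm g f)
      (comp_cls _ hm' g' f')).trans ?_
    refine Eq.trans ?_ (comp_cls _ hm' (.mul g g') fun i => .mul (f _) (f' i)).symm
    exact cls_eq fun M v => comp_mul_comp_of_eq _ _ (Term.π_eval v.π_val g') k hm hm' _ _

variable {P}

/-- The homomorphism out of the presented action operad which corresponds to a model. -/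
noncomputable def lift {M : ActionOperad.{u}} (v : P.Model M) : P.presented ⟶ M where
  app _ := Quotient.lift (Term.eval M v.val) fun _ _ h => h M v
  map_one := rfl
  map_comp k hm x y := by
    obtain ⟨x, rfl⟩ := exists_cls x
    obtain ⟨y, rfl⟩ := exists_cls_family y
    refine (congrArg _ (comp_cls k hm x y)).trans ?_
    rfl
  map_mul x y := by
    obtain ⟨x, rfl⟩ := exists_cls x
    obtain ⟨y, rfl⟩ := exists_cls y
    rfl
  toPerm_app x := by
    obtain ⟨x, rfl⟩ := exists_cls x
    exact Term.π_eval v.π_val x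

variable (P) in
/-- The generators, as operations of the presented action operad. -/
def gen (n : ℕ) (x : P.X n) : P.presented.obj n :=
  cls (.var x)

/-- Evaluating an expression at the generators of the presented action operad gives its class; hence
the generators satisfy the relations, and they determine all homomorphisms. -/
theorem eval_gen {n : ℕ} (t : Term P.X n) : t.eval P.presented P.gen = cls t := by
  induction t with
  | var x => rfl
  | unit => rfl
  | comp k hm x y hx hy =>
    rw [Term.eval, hx, funext hy]
    exact comp_cls k hm x y
  | one n => rfl
  | mul x y hx hy =>
    rw [Term.eval, hx, hy]
    rfl
  | inv x hx =>
    rw [Term.eval, hx]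
    rfl

theorem eval_gen_eq {n : ℕ} {s t : Term P.X n} (h : P.R s t) :
    s.eval P.presented P.gen = t.eval P.presented P.gen := by
  rw [eval_gen, eval_gen]
  exact cls_eq fun M v => v.eval_eq h

theorem presented_hom_ext {M : ActionOperad.{u}} {a b : P.presented ⟶ M}
    (h : ∀ n x, a.app n (P.gen n x) = b.app n (P.gen n x)) : a = b := by
  refine hom_ext fun n x => ?_
  obtain ⟨t, rfl⟩ := exists_cls x
  rw [← eval_gen, Term.eval_app, Term.eval_app, funext fun n => funext (h n)]

end Presentation

end ActionOperad

/-! ### Free action operads -/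

namespace ActionOperad

/-- An element of the underlying set of `M` which lies over `σ ∈ Σ_n` is an `n`-ary operation. -/
theorem exists_eq_mk_of_forget {M : ActionOperad.{u}} {n : ℕ} {σ : Equiv.Perm (Fin n)}
    (z : Σ n, M.obj n) (h : (forget.obj M).hom z = ULift.up ⟨n, σ⟩) :
    ∃ y : M.obj n, M.π.toPerm y = σ ∧ z = ⟨n, y⟩ := by
  obtain ⟨n', y⟩ := z
  obtain ⟨rfl, h⟩ := Sigma.mk.inj (ULift.up_injective h)
  exact ⟨y, eq_of_heq h, rfl⟩

theorem exists_hom_eq_up (A : SymmCollection.{u}) (a : A.left) :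
    ∃ (n : ℕ) (σ : Equiv.Perm (Fin n)), A.hom a = ULift.up ⟨n, σ⟩ :=
  ⟨_, _, rfl⟩

/-- The presentation with the elements of a collection as generators, and no relations. -/
def freePresentation (A : SymmCollection.{u}) : Presentation.{u} where
  X n := Σ σ : Equiv.Perm (Fin n), {a : A.left // A.hom a = ULift.up ⟨n, σ⟩}
  p _ x := x.1
  R _ _ := False
  perm_eq h := h.elim

/-- The free action operad on a collection. -/
noncomputable def free (A : SymmCollection.{u}) : ActionOperad.{u} :=
  (freePresentation A).presented

/-- The generator of the free action operad given by an element of the collection. -/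
def free.gen {A : SymmCollection.{u}} {n : ℕ} {σ : Equiv.Perm (Fin n)} (a : A.left)
    (ha : A.hom a = ULift.up ⟨n, σ⟩) : (free A).obj n :=
  (freePresentation A).gen n ⟨σ, a, ha⟩

/-- `free.unit` lists the generator given by `a` over the permutation read off from `A.hom a`; this is
the generator over any `σ` known to be that permutation. -/
theorem free.sigma_gen_eq {A : SymmCollection.{u}} {n : ℕ} {σ : Equiv.Perm (Fin n)} (a : A.left)
    (ha : A.hom a = ULift.up ⟨n, σ⟩) :
    (⟨_, free.gen a rfl⟩ : Σ n, (free A).obj n) = ⟨n, free.gen a ha⟩ := by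
  suffices ∀ (s : SymmSet.{u}) (hs : A.hom a = s) (n : ℕ) (σ : Equiv.Perm (Fin n))
      (h : s = ULift.up ⟨n, σ⟩), (⟨s.down.1, free.gen a hs⟩ : Σ n, (free A).obj n) =
      ⟨n, free.gen a (hs.trans h)⟩ from this _ rfl n σ ha
  rintro s hs n σ rfl
  rfl

/-- The inclusion of the generators. -/
noncomputable def free.unit (A : SymmCollection.{u}) : A ⟶ forget.obj (free A) :=
  Over.homMk (TypeCat.ofHom fun a => ⟨_, free.gen a rfl⟩) rfl

/-- Maps of action operads out of the free action operad, restricted to the generators. -/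
noncomputable def free.restrict (A : SymmCollection.{u}) (M : ActionOperad.{u}) (a : free A ⟶ M) :
    A ⟶ forget.obj M :=
  free.unit A ≫ forget.map a

theorem free.restrict_left {A : SymmCollection.{u}} {M : ActionOperad.{u}} (f : free A ⟶ M)
    {n : ℕ} {σ : Equiv.Perm (Fin n)} (a : A.left) (ha : A.hom a = ULift.up ⟨n, σ⟩) :
    (free.restrict A M f).left a = (⟨n, f.app n (free.gen a ha)⟩ : Σ n, M.obj n) :=
  congrArg (fun z : Σ n, (free A).obj n => (⟨z.1, f.app z.1 z.2⟩ : Σ n, M.obj n))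
    (free.sigma_gen_eq a ha)

theorem free.restrict_bijective (A : SymmCollection.{u}) (M : ActionOperad.{u}) :
    Function.Bijective (free.restrict A M) := by
  constructor
  · intro f g h
    refine Presentation.presented_hom_ext ?_
    rintro n ⟨σ, a, ha⟩
    have := congrArg (fun t : A ⟶ forget.obj M => t.left a) h
    dsimp only at this
    rw [free.restrict_left f a ha, free.restrict_left g a ha] at this
    exact sigma_mk_injective this
  · intro g
    have hg (a : A.left) : (forget.obj M).hom (g.left a) = A.hom a :=
      ConcreteCategory.congr_hom (Over.w g) a
    choose y hy hy' using fun (n : ℕ) (x : (freePresentation A).X n) =>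
      exists_eq_mk_of_forget (g.left x.2.1) ((hg x.2.1).trans x.2.2)
    refine ⟨Presentation.lift ⟨y, hy, fun h => h.elim⟩, ?_⟩
    ext a
    obtain ⟨n, σ, ha⟩ := exists_hom_eq_up A a
    exact (free.restrict_left _ a ha).trans (hy' n ⟨σ, a, ha⟩).symm

/-- Maps of action operads out of the free action operad on `A` are maps of collections out of
`A`. -/
noncomputable def free.equiv (A : SymmCollection.{u}) (M : ActionOperad.{u}) :
    (free A ⟶ M) ≃ (A ⟶ forget.obj M) :=
  Equiv.ofBijective _ (free.restrict_bijective A M)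

theorem free.equiv_comp (A : SymmCollection.{u}) (M N : ActionOperad.{u}) (b : M ⟶ N)
    (a : free A ⟶ M) : free.equiv A N (a ≫ b) = free.equiv A M a ≫ forget.map b := by
  simp only [free.equiv, Equiv.ofBijective_apply, free.restrict, Category.assoc]
  rfl

/-- The free action operad functor. -/
noncomputable def freeFunctor : SymmCollection.{u} ⥤ ActionOperad.{u} :=
  Adjunction.leftAdjointOfEquiv free.equiv free.equiv_comp

/-- The free action operad functor is left adjoint to the forgetful functor. -/
noncomputable def freeAdjunction : freeFunctor.{u} ⊣ forget.{u} :=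
  Adjunction.adjunctionOfEquivLeft free.equiv free.equiv_comp

/-! ### Colimits of action operads -/

section

variable {J : Type u} [SmallCategory J] (F : J ⥤ ActionOperad.{u})

/-- The relations between the operations of the action operads `F j` which hold in every cocone
under `F`. -/
inductive colimitRel : ∀ {n : ℕ}, Term (fun n => Σ j, (F.obj j).obj n) n →
    Term (fun n => Σ j, (F.obj j).obj n) n → Prop
  | unit (j : J) : colimitRel (.var ⟨j, (F.obj j).one⟩) .unit
  | comp (j : J) {n m : ℕ} (k : Fin n → ℕ) (hm : ∑ i, k i = m) (x : (F.obj j).obj n)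
      (y : ∀ i, (F.obj j).obj (k i)) :
      colimitRel (.var ⟨j, (F.obj j).comp k hm x y⟩)
        (.comp k hm (.var ⟨j, x⟩) fun i => .var ⟨j, y i⟩)
  | mul (j : J) {n : ℕ} (x y : (F.obj j).obj n) :
      colimitRel (.var ⟨j, x * y⟩) (.mul (.var ⟨j, x⟩) (.var ⟨j, y⟩))
  | map {i j : J} (f : i ⟶ j) {n : ℕ} (x : (F.obj i).obj n) :
      colimitRel (.var ⟨j, (F.map f).app n x⟩) (.var ⟨i, x⟩)

/-- The colimit of a diagram of action operads, presented by the operations of its members. -/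
def colimitPresentation : Presentation.{u} where
  X n := Σ j, (F.obj j).obj n
  p _ x := (F.obj x.1).π.toPerm x.2
  R := colimitRel F
  perm_eq h := by
    cases h with
    | unit j => exact (F.obj j).π.map_one
    | comp j k hm x y => exact π_comp k hm x y
    | mul j x y => exact π_mul _ x y
    | map f x => exact (F.map f).toPerm_app x

/-- The colimit cocone of a diagram of action operads. -/
noncomputable def colimitCocone : Cocone F where
  pt := (colimitPresentation F).presented
  ι :=
    { app j :=
        { app n x := (colimitPresentation F).gen n ⟨j, x⟩
          map_one := (colimitPresentation F).eval_gen_eq (.unit j)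
          map_comp k hm x y := (colimitPresentation F).eval_gen_eq (.comp j k hm x y)
          map_mul x y := (colimitPresentation F).eval_gen_eq (.mul j x y)
          toPerm_app _ := rfl }
      naturality _ _ f := hom_ext fun _ x => (colimitPresentation F).eval_gen_eq (.map f x) }

/-- The colimit cocone is universal: cocones under `F` are models of its presentation. -/
noncomputable def isColimitColimitCocone : IsColimit (colimitCocone F) where
  desc s := Presentation.lift
    { val n x := (s.ι.app x.1).app n x.2
      π_val _ x := (s.ι.app x.1).toPerm_app x.2
      eval_eq h := by
        cases h with
        | unit j => exact (s.ι.app j).map_one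
        | comp j k hm x y => exact (s.ι.app j).map_comp k hm x y
        | mul j x y => exact (s.ι.app j).map_mul x y
        | map f x => exact congrArg (fun a : Hom _ _ => a.app _ x) (s.w f) }
  fac _ _ := rfl
  uniq s m hm := Presentation.presented_hom_ext fun n x =>
    congrArg (fun a : Hom _ _ => a.app n x.2) (hm x.1)

end

instance : HasColimitsOfSize.{u, u} ActionOperad.{u} where
  has_colimits_of_shape _ _ := ⟨fun F => ⟨⟨⟨colimitCocone F, isColimitColimitCocone F⟩⟩⟩⟩

end ActionOperad

/-! ### Filtered colimits of action operads -/

namespace ActionOperad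

theorem functor_map_id {J : Type u} [SmallCategory J] (F : J ⥤ ActionOperad.{u}) (j : J) {n : ℕ}
    (x : (F.obj j).obj n) : (F.map (𝟙 j)).app n x = x := by
  rw [F.map_id]
  rfl

theorem functor_map_comp {J : Type u} [SmallCategory J] (F : J ⥤ ActionOperad.{u}) {i j k : J}
    (f : i ⟶ j) (g : j ⟶ k) {n : ℕ} (x : (F.obj i).obj n) :
    (F.map (f ≫ g)).app n x = (F.map g).app n ((F.map f).app n x) := by
  rw [F.map_comp]
  rfl

namespace FilteredColimit

variable {J : Type u} [SmallCategory J] [IsFiltered J] (F : J ⥤ ActionOperad.{u})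

/-- Two operations of members of the diagram are identified when they become equal at some later
stage. -/
def setoid (n : ℕ) : Setoid (Σ j, (F.obj j).obj n) where
  r x y := ∃ (k : J) (f : x.1 ⟶ k) (g : y.1 ⟶ k), (F.map f).app n x.2 = (F.map g).app n y.2
  iseqv :=
    { refl x := ⟨x.1, 𝟙 _, 𝟙 _, rfl⟩
      symm := fun ⟨k, f, g, h⟩ => ⟨k, g, f, h.symm⟩
      trans := by
        rintro x y z ⟨k, f, g, h⟩ ⟨k', f', g', h'⟩
        obtain ⟨l, a, b, hab⟩ := IsFiltered.span g f'
        refine ⟨l, f ≫ a, g' ≫ b, ?_⟩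
        rw [functor_map_comp, h, ← functor_map_comp, hab, functor_map_comp, h', functor_map_comp] }

/-- The `n`-ary operations of the filtered colimit. -/
def Obj (n : ℕ) : Type u :=
  Quotient (setoid F n)

variable {F}

/-- The map from a member of the diagram to the colimit. -/
def ι (j : J) {n : ℕ} (x : (F.obj j).obj n) : Obj F n :=
  Quotient.mk (setoid F n) ⟨j, x⟩

theorem ι_map {i j : J} (f : i ⟶ j) {n : ℕ} (x : (F.obj i).obj n) :
    ι j ((F.map f).app n x) = ι i x :=
  Quotient.sound ⟨j, 𝟙 j, f, functor_map_id F j _⟩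

theorem exists_of_ι_eq {i j : J} {n : ℕ} {x : (F.obj i).obj n} {y : (F.obj j).obj n}
    (h : ι i x = ι j y) :
    ∃ (k : J) (f : i ⟶ k) (g : j ⟶ k), (F.map f).app n x = (F.map g).app n y :=
  Quotient.exact h

theorem exists_ι {n : ℕ} (x : Obj F n) : ∃ j, ∃ y : (F.obj j).obj n, x = ι j y :=
  ⟨_, _, (Quotient.out_eq x).symm⟩

theorem exists_ι_family {I : Type*} [Finite I] {d : I → ℕ} (x : ∀ a, Obj F (d a)) :
    ∃ j, ∃ y : ∀ a, (F.obj j).obj (d a), ∀ a, x a = ι j (y a) := by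
  classical
  cases nonempty_fintype I
  choose i y hy using fun a => exists_ι (x a)
  obtain ⟨j, hj⟩ := IsFiltered.sup_objs_exists (Finset.univ.image i)
  have f a := (hj (Finset.mem_image_of_mem i (Finset.mem_univ a))).some
  exact ⟨j, fun a => (F.map (f a)).app _ (y a), fun a => (hy a).trans (ι_map _ _).symm⟩

/-- Finitely many identifications in the colimit hold at a common later stage. -/
theorem exists_map_eq_family {I : Type*} [Finite I] {d : I → ℕ} {i j : J}
    {x : ∀ a, (F.obj i).obj (d a)} {y : ∀ a, (F.obj j).obj (d a)}
    (h : ∀ a, ι i (x a) = ι j (y a)) :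
    ∃ (k : J) (f : i ⟶ k) (g : j ⟶ k),
      ∀ a, (F.map f).app _ (x a) = (F.map g).app _ (y a) := by
  classical
  cases nonempty_fintype I
  choose l f g hfg using fun a => exists_of_ι_eq (h a)
  obtain ⟨K, hK⟩ := IsFiltered.sup_objs_exists (Finset.univ.image l)
  have t a := (hK (Finset.mem_image_of_mem l (Finset.mem_univ a))).some
  -- The maps `i ⟶ K` and `j ⟶ K` found for the various `a` are made independent of `a`.
  obtain ⟨s, α, β, hs⟩ := IsFiltered.crown (k₁ := K) (k₂ := IsFiltered.max i j)
    (Sum.elim (fun _ : I => i) fun _ : I => j)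
    (fun | .inl a => f a ≫ t a | .inr a => g a ≫ t a)
    (fun | .inl _ => IsFiltered.leftToMax i j | .inr _ => IsFiltered.rightToMax i j)
  refine ⟨s, IsFiltered.leftToMax i j ≫ β, IsFiltered.rightToMax i j ≫ β, fun a => ?_⟩
  have h₁ : (f a ≫ t a) ≫ α = IsFiltered.leftToMax i j ≫ β := hs (.inl a)
  have h₂ : (g a ≫ t a) ≫ α = IsFiltered.rightToMax i j ≫ β := hs (.inr a)
  rw [← h₁, ← h₂, Category.assoc, Category.assoc, functor_map_comp, hfg a,
    functor_map_comp F (g a)]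

/-- One operation and a finite family of operations come from a common member of the diagram. -/
theorem exists_ι_comp {n : ℕ} {k : Fin n → ℕ} (x : Obj F n) (y : ∀ i, Obj F (k i)) :
    ∃ (j : J) (x' : (F.obj j).obj n) (y' : ∀ i, (F.obj j).obj (k i)),
      x = ι j x' ∧ y = fun i => ι j (y' i) := by
  obtain ⟨j, z, hz⟩ := exists_ι_family (d := fun a : Option (Fin n) => a.elim n k)
    (fun | none => x | some i => y i)
  exact ⟨j, z none, fun i => z (some i), hz none, funext fun i => hz (some i)⟩

theorem exists_ι_pair {n m : ℕ} (x : Obj F n) (y : Obj F m) :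
    ∃ (j : J) (x' : (F.obj j).obj n) (y' : (F.obj j).obj m), x = ι j x' ∧ y = ι j y' := by
  obtain ⟨j, z, hz⟩ := exists_ι_family (d := fun a : Bool => cond a n m)
    (fun | true => x | false => y)
  exact ⟨j, z true, z false, hz true, hz false⟩

/-- The operadic multiplication of the colimit, computed at a common stage. -/
noncomputable def comp {n m : ℕ} (k : Fin n → ℕ) (hm : ∑ i, k i = m) (x : Obj F n)
    (y : ∀ i, Obj F (k i)) : Obj F m :=
  ι (exists_ι_comp x y).choose ((F.obj _).comp k hm (exists_ι_comp x y).choose_spec.choose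
    (exists_ι_comp x y).choose_spec.choose_spec.choose)

theorem comp_ι {n m : ℕ} (k : Fin n → ℕ) (hm : ∑ i, k i = m) (j : J) (x : (F.obj j).obj n)
    (y : ∀ i, (F.obj j).obj (k i)) :
    comp k hm (ι j x) (fun i => ι j (y i)) = ι j ((F.obj j).comp k hm x y) := by
  have h := exists_ι_comp (ι j x) (fun i => ι j (y i))
  have hx := h.choose_spec.choose_spec.choose_spec.1
  have hy := h.choose_spec.choose_spec.choose_spec.2
  unfold comp
  generalize h.choose_spec.choose_spec.choose = y' at *
  generalize h.choose_spec.choose = x' at *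
  generalize h.choose = i at *
  obtain ⟨l, f, g, hl⟩ := exists_map_eq_family (d := fun a : Option (Fin n) => a.elim n k)
    (x := fun | none => x' | some i => y' i) (y := fun | none => x | some i => y i)
    (fun | none => hx.symm | some i => (congrFun hy i).symm)
  rw [← ι_map f, ← ι_map g, (F.map f).map_comp, (F.map g).map_comp]
  have h₁ : (F.map f).app _ x' = (F.map g).app _ x := hl none
  have h₂ : (fun i => (F.map f).app _ (y' i)) = fun i => (F.map g).app _ (y i) :=
    funext fun i => hl (some i)
  rw [h₁, h₂]

noncomputable instance (n : ℕ) : Mul (Obj F n) :=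
  ⟨fun x y => ι (exists_ι_pair x y).choose ((exists_ι_pair x y).choose_spec.choose *
    (exists_ι_pair x y).choose_spec.choose_spec.choose)⟩

theorem mul_ι {n : ℕ} (j : J) (x y : (F.obj j).obj n) : ι j x * ι j y = ι j (x * y) := by
  have h := exists_ι_pair (ι j x) (ι j y)
  have hx := h.choose_spec.choose_spec.choose_spec.1
  have hy := h.choose_spec.choose_spec.choose_spec.2
  change ι h.choose (h.choose_spec.choose * h.choose_spec.choose_spec.choose) = _
  generalize h.choose_spec.choose_spec.choose = y' at *
  generalize h.choose_spec.choose = x' at *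
  generalize h.choose = i at *
  obtain ⟨l, f, g, hl⟩ := exists_map_eq_family (d := fun _ : Bool => n)
    (x := fun a => cond a x' y') (y := fun a => cond a x y)
    (fun | true => hx.symm | false => hy.symm)
  rw [← ι_map f, ← ι_map g, (F.map f).map_mul, (F.map g).map_mul]
  have h₁ : (F.map f).app _ x' = (F.map g).app _ x := hl true
  have h₂ : (F.map f).app _ y' = (F.map g).app _ y := hl false
  rw [h₁, h₂]

instance (n : ℕ) : Inv (Obj F n) :=
  ⟨Quotient.map (fun x => ⟨x.1, x.2⁻¹⟩) fun _ _ ⟨k, f, g, h⟩ =>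
    ⟨k, f, g, by rw [(F.map f).map_inv, (F.map g).map_inv, h]⟩⟩

theorem inv_ι {n : ℕ} (j : J) (x : (F.obj j).obj n) : (ι j x)⁻¹ = ι j x⁻¹ :=
  rfl

noncomputable instance (n : ℕ) : One (Obj F n) :=
  ⟨ι (IsFiltered.nonempty (C := J)).some 1⟩

theorem one_eq_ι (n : ℕ) (j : J) : (1 : Obj F n) = ι j 1 := by
  change ι _ 1 = _
  rw [← ι_map (IsFiltered.leftToMax _ j), ← ι_map (IsFiltered.rightToMax _ j) 1,
    Hom.map_group_one, Hom.map_group_one]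

variable (F) in
/-- The operadic unit of the colimit. -/
noncomputable def unit : Obj F 1 :=
  ι (IsFiltered.nonempty (C := J)).some (F.obj _).one

theorem unit_eq_ι (j : J) : unit F = ι j (F.obj j).one := by
  rw [unit, ← ι_map (IsFiltered.leftToMax _ j), ← ι_map (IsFiltered.rightToMax _ j),
    (F.map _).map_one, (F.map _).map_one]

/-- The permutation underlying an operation of the colimit. -/
def toPerm {n : ℕ} : Obj F n → Equiv.Perm (Fin n) :=
  Quotient.lift (fun x => (F.obj x.1).π.toPerm x.2) fun _ _ ⟨_, f, g, h⟩ => by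
    rw [← (F.map f).toPerm_app, ← (F.map g).toPerm_app, h]

noncomputable instance group (n : ℕ) : Group (Obj F n) :=
  Group.ofLeftAxioms
    (fun x y z => by
      obtain ⟨j, w, hw⟩ := exists_ι_family (d := fun _ : Fin 3 => n) ![x, y, z]
      obtain rfl : x = ι j (w 0) := hw 0
      obtain rfl : y = ι j (w 1) := hw 1
      obtain rfl : z = ι j (w 2) := hw 2
      simp only [mul_ι, mul_assoc])
    (fun x => by
      obtain ⟨j, x, rfl⟩ := exists_ι x
      rw [one_eq_ι n j, mul_ι, one_mul])
    (fun x => by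
      obtain ⟨j, x, rfl⟩ := exists_ι x
      rw [one_eq_ι n j, inv_ι, mul_ι, inv_mul_cancel])

theorem comp_assoc {m M : ℕ} (n : Fin m → ℕ) (p : Fin (∑ i, n i) → ℕ) (hM : ∑ l, p l = M)
    (hM' : ∑ i, ∑ j, p (finSigmaFinEquiv ⟨i, j⟩) = M)
    (f : Obj F m) (g : ∀ i, Obj F (n i)) (h : ∀ l, Obj F (p l)) :
    comp (fun i => ∑ j, p (finSigmaFinEquiv ⟨i, j⟩)) hM' f
        (fun i => comp (fun j => p (finSigmaFinEquiv ⟨i, j⟩)) rfl (g i)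
          (fun j => h (finSigmaFinEquiv ⟨i, j⟩))) =
      comp p hM (comp n rfl f g) h := by
  obtain ⟨j, z, hz⟩ := exists_ι_family
    (d := fun a : Unit ⊕ Fin m ⊕ Fin (∑ i, n i) => a.elim (fun _ => m) (Sum.elim n p))
    (fun | .inl _ => f | .inr (.inl i) => g i | .inr (.inr l) => h l)
  obtain rfl : f = ι j (z (.inl ())) := hz (.inl ())
  obtain rfl : g = fun i => ι j (z (.inr (.inl i))) := funext fun i => hz (.inr (.inl i))
  obtain rfl : h = fun l => ι j (z (.inr (.inr l))) := funext fun l => hz (.inr (.inr l))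
  refine Eq.trans (congrArg (comp _ hM' _) (funext fun i => comp_ι _ rfl j _ _)) ?_
  refine Eq.trans ?_ (congrArg (comp p hM · _) (comp_ι n rfl j _ _).symm)
  refine (comp_ι _ hM' j _ _).trans (Eq.trans ?_ (comp_ι p hM j _ _).symm)
  exact congrArg (ι j) ((F.obj j).assoc n p hM hM' _ _ fun l => z (.inr (.inr l)))

/-- The action operad axiom in the colimit.  The permutation underlying `g'` is given up to equality
because it would otherwise change with the stage at which `g'` is represented. -/
theorem comp_mul_comp {n m : ℕ} (g g' : Obj F n) {σ : Equiv.Perm (Fin n)} (hσ : toPerm g' = σ)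
    (k : Fin n → ℕ) (hm : ∑ i, k i = m) (hm' : ∑ i, k (σ i) = m)
    (f : ∀ i, Obj F (k i)) (f' : ∀ i, Obj F (k (σ i))) :
    comp k hm g f * comp (fun i => k (σ i)) hm' g' f' =
      comp (fun i => k (σ i)) hm' (g * g') (fun i => f (σ i) * f' i) := by
  obtain ⟨j, z, hz⟩ := exists_ι_family
    (d := fun a : Bool ⊕ Fin n ⊕ Fin n => a.elim (fun _ => n) (Sum.elim k fun i => k (σ i)))
    (fun | .inl b => cond b g g' | .inr (.inl i) => f i | .inr (.inr i) => f' i)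
  obtain rfl : g = ι j (z (.inl true)) := hz (.inl true)
  obtain rfl : g' = ι j (z (.inl false)) := hz (.inl false)
  obtain rfl : f = fun i => ι j (z (.inr (.inl i))) := funext fun i => hz (.inr (.inl i))
  obtain rfl : f' = fun i => ι j (z (.inr (.inr i))) := funext fun i => hz (.inr (.inr i))
  refine (congrArg₂ (· * ·) (comp_ι k hm j _ _) (comp_ι _ hm' j _ _)).trans ?_
  refine Eq.trans ?_ (congrArg₂ (comp _ hm') (mul_ι j _ _) (funext fun i => mul_ι j _ _)).symm
  refine (mul_ι j _ _).trans (Eq.trans ?_ (comp_ι _ hm' j _ _).symm)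
  exact congrArg (ι j) (comp_mul_comp_of_eq _ _ hσ k hm hm' (fun i => z (.inr (.inl i))) _)

variable (F) in
/-- The operad underlying the filtered colimit. -/
noncomputable def operad : NSOperad.{u} where
  obj := Obj F
  one := unit F
  comp := comp
  one_comp x := by
    obtain ⟨j, x, rfl⟩ := exists_ι x
    rw [unit_eq_ι j, comp_ι, (F.obj j).one_comp]
  comp_one x := by
    obtain ⟨j, x, rfl⟩ := exists_ι x
    rw [unit_eq_ι j, comp_ι, (F.obj j).comp_one]
  assoc := comp_assoc

variable (F) in
/-- The filtered colimit of the diagram. -/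
noncomputable def colim : ActionOperad.{u} where
  toNSOperad := operad F
  group := group
  π :=
    { app _ := toPerm
      map_one := (F.obj _).π.map_one
      map_comp k hm x y := by
        obtain ⟨j, x, y, rfl, rfl⟩ := exists_ι_comp x y
        exact (congrArg toPerm (comp_ι k hm j x y)).trans (π_comp k hm x y) }
  π_mul x y := by
    obtain ⟨j, x, y, rfl, rfl⟩ := exists_ι_pair x y
    exact (congrArg toPerm (mul_ι j x y)).trans (π_mul _ x y)
  comp_mul_comp g g' k hm hm' f f' := comp_mul_comp g g' rfl k hm hm' f f'

variable (F) in
/-- The cocone formed by the filtered colimit. -/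
noncomputable def cocone : Cocone F where
  pt := colim F
  ι :=
    { app j :=
        { app _ x := ι j x
          map_one := (unit_eq_ι j).symm
          map_comp k hm x y := (comp_ι k hm j x y).symm
          map_mul x y := (mul_ι j x y).symm
          toPerm_app _ := rfl }
      naturality _ _ f := hom_ext fun _ x => ι_map f x }

/-- The function on operations induced by a cocone. -/
def desc (s : Cocone F) (n : ℕ) : Obj F n → s.pt.obj n :=
  Quotient.lift (fun x => (s.ι.app x.1).app n x.2) fun x y ⟨k, f, g, h⟩ => by
    rw [← s.w f, ← s.w g, comp_app, comp_app, h]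

variable (F) in
/-- The filtered colimit is universal. -/
noncomputable def isColimitCocone : IsColimit (cocone F) where
  desc s :=
    { app := desc s
      map_one := (s.ι.app _).map_one
      map_comp k hm x y := by
        obtain ⟨j, x, y, rfl, rfl⟩ := exists_ι_comp x y
        exact (congrArg (desc s _) (comp_ι k hm j x y)).trans ((s.ι.app j).map_comp k hm x y)
      map_mul x y := by
        obtain ⟨j, x, y, rfl, rfl⟩ := exists_ι_pair x y
        exact (congrArg (desc s _) (mul_ι j x y)).trans ((s.ι.app j).map_mul x y)
      toPerm_app x := by
        obtain ⟨j, x, rfl⟩ := exists_ι x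
        exact (s.ι.app j).toPerm_app x }
  fac _ _ := rfl
  uniq s m hm := hom_ext fun n x => by
    obtain ⟨j, x, rfl⟩ := exists_ι x
    exact congrArg (fun a : Hom _ _ => a.app n x) (hm j)

end FilteredColimit

/-- On underlying sets, the filtered colimit is the colimit of the underlying sets. -/
noncomputable def isColimitForgetCocone {J : Type u} [SmallCategory J] [IsFiltered J]
    (F : J ⥤ ActionOperad.{u}) :
    IsColimit ((forget ⋙ Over.forget _).mapCocone (FilteredColimit.cocone F)) := by
  refine Types.FilteredColimit.isColimitOf _ _ ?_ ?_
  · rintro ⟨n, x⟩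
    obtain ⟨j, x, rfl⟩ := FilteredColimit.exists_ι x
    exact ⟨j, ⟨n, x⟩, rfl⟩
  · rintro i j ⟨n, x⟩ ⟨m, y⟩ h
    obtain ⟨rfl, h⟩ := Sigma.mk.inj h
    obtain ⟨k, f, g, h⟩ := FilteredColimit.exists_of_ι_eq (eq_of_heq h)
    exact ⟨k, f, g, congrArg (Sigma.mk n) h⟩

instance : PreservesFilteredColimits forget.{u} where
  preserves_filtered_colimits _ _ _ :=
    { preservesColimit {F} :=
        preservesColimit_of_preserves_colimit_cocone (FilteredColimit.isColimitCocone F)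
          (isColimitOfReflects (Over.forget _) (isColimitForgetCocone F)) }

end ActionOperad

/-! ### Finitely presentable generators -/

namespace ActionOperad

/-- A map of action operads which is bijective on operations is an isomorphism. -/
theorem isIso_of_bijective {L M : ActionOperad.{u}} (a : L ⟶ M)
    (h : ∀ n, Function.Bijective (a.app n)) : IsIso a := by
  let e n := Equiv.ofBijective _ (h n)
  have he n (x : M.obj n) : a.app n ((e n).symm x) = x := (e n).apply_symm_apply x
  refine ⟨{ app := fun n => (e n).symm
            map_one := (h _).1 ?_
            map_comp := fun k hm x y => (h _).1 ?_
            map_mul := fun x y => (h _).1 ?_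
            toPerm_app := fun x => ?_ }, hom_ext fun n => (e n).symm_apply_apply, hom_ext he⟩
  · rw [he, a.map_one]
  · simp only [a.map_comp, he]
  · simp only [a.map_mul, he]
  · rw [← a.toPerm_app, he]

/-- The collection with a single element, which lies over `s`. -/
def point (s : SymmSet.{u}) : SymmCollection.{u} :=
  Over.mk (Y := PUnit.{u + 1}) (TypeCat.ofHom fun _ => s)

/-- The map of action operads out of a free one on a single generator which sends the generator to
a given operation `x`. -/
noncomputable def elt {L : ActionOperad.{u}} {n : ℕ} {σ : Equiv.Perm (Fin n)} (x : L.obj n)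
    (hx : L.π.toPerm x = σ) : free (point ⟨⟨n, σ⟩⟩) ⟶ L :=
  (free.equiv _ _).symm (Over.homMk (TypeCat.ofHom fun _ => (⟨n, x⟩ : Σ n, L.obj n)) (by
    subst hx
    rfl))

theorem equiv_elt_comp {L M : ActionOperad.{u}} {n : ℕ} {σ : Equiv.Perm (Fin n)} (x : L.obj n)
    (hx : L.π.toPerm x = σ) (f : L ⟶ M) :
    (free.equiv _ _ (elt x hx ≫ f)).left PUnit.unit = (⟨n, f.app n x⟩ : Σ n, M.obj n) := by
  rw [free.equiv_comp, elt, Equiv.apply_symm_apply]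
  rfl

theorem app_eq_of_elt_comp_eq {L L' M : ActionOperad.{u}} {n : ℕ} {σ : Equiv.Perm (Fin n)}
    {x : L.obj n} {hx : L.π.toPerm x = σ} {x' : L'.obj n} {hx' : L'.π.toPerm x' = σ}
    {f : L ⟶ M} {f' : L' ⟶ M} (h : elt x hx ≫ f = elt x' hx' ≫ f') :
    f.app n x = f'.app n x' := by
  have := equiv_elt_comp x hx f
  rw [h, equiv_elt_comp] at this
  exact (sigma_mk_injective this).symm

theorem elt_comp_eq_of_app_eq {L L' M : ActionOperad.{u}} {n : ℕ} {σ : Equiv.Perm (Fin n)}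
    {x : L.obj n} {hx : L.π.toPerm x = σ} {x' : L'.obj n} {hx' : L'.π.toPerm x' = σ}
    {f : L ⟶ M} {f' : L' ⟶ M} (h : f.app n x = f'.app n x') :
    elt x hx ≫ f = elt x' hx' ≫ f' := by
  refine (free.equiv _ _).injective ?_
  ext ⟨⟩
  exact (equiv_elt_comp x hx f).trans ((congrArg _ h).trans (equiv_elt_comp x' hx' f').symm)

/-- Every map out of a free action operad on one generator is given by an operation. -/
theorem exists_eq_elt {L : ActionOperad.{u}} {n : ℕ} {σ : Equiv.Perm (Fin n)}
    (f : free (point ⟨⟨n, σ⟩⟩) ⟶ L) : ∃ (x : L.obj n) (hx : L.π.toPerm x = σ), f = elt x hx := by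
  obtain ⟨x, hx, h⟩ := exists_eq_mk_of_forget ((free.equiv _ _ f).left PUnit.unit)
    (ConcreteCategory.congr_hom (Over.w (free.equiv _ _ f)) PUnit.unit)
  refine ⟨x, hx, (free.equiv _ _).injective ?_⟩
  ext ⟨⟩
  rw [elt, Equiv.apply_symm_apply]
  exact h

/-- The free action operads on one generator. -/
def freeOnPoint : ObjectProperty ActionOperad.{u} :=
  .ofObj fun s : SymmSet.{u} => free (point s)

instance : ObjectProperty.Small.{u} freeOnPoint.{u} :=
  inferInstanceAs (ObjectProperty.Small.{u} (.ofObj fun s : SymmSet.{u} => free (point s)))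

theorem freeOnPoint_isStrongGenerator : freeOnPoint.{u}.IsStrongGenerator := by
  rw [ObjectProperty.isStrongGenerator_iff]
  refine ⟨fun L M f g h => hom_ext fun n x => ?_, fun L M i _ h => isIso_of_bijective i ?_⟩
  · exact app_eq_of_elt_comp_eq (h _ (ObjectProperty.ofObj_apply _ _) (elt x rfl))
  · refine fun n => ⟨fun x x' hx => ?_, fun y => ?_⟩
    · -- Injectivity: two operations with the same image lie over the same permutation.
      have hπ : L.π.toPerm x' = L.π.toPerm x := by
        rw [← i.toPerm_app, ← i.toPerm_app x, hx]
      have := (cancel_mono i).1 (elt_comp_eq_of_app_eq (hx := rfl) (hx' := hπ) hx)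
      exact app_eq_of_elt_comp_eq (f := 𝟙 L) (f' := 𝟙 L) (congrArg (· ≫ 𝟙 L) this)
    · obtain ⟨φ, hφ⟩ := h _ (ObjectProperty.ofObj_apply _ _) (elt y rfl)
      obtain ⟨x, hx, rfl⟩ := exists_eq_elt φ
      exact ⟨x, app_eq_of_elt_comp_eq (f' := 𝟙 M) (hφ.trans (Category.comp_id _).symm)⟩

/-- One-point collections are finitely presentable: a map from one to a collection is an element of
one of its fibres over `𝕊`. -/
theorem isFinitelyPresentable_point (s : SymmSet.{u}) : IsFinitelyPresentable.{u} (point s) := by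
  rw [isFinitelyPresentable_iff_preservesFilteredColimits]
  refine ⟨fun J _ _ => ⟨fun {F} => ⟨fun {c} hc => ⟨?_⟩⟩⟩⟩
  have hc' := isColimitOfPreserves (Over.forget _) hc
  refine Types.FilteredColimit.isColimitOf _ _ (fun f => ?_) fun i j f g h => ?_
  · obtain ⟨j, y, hy⟩ := Types.jointly_surjective_of_isColimit hc' (f.left PUnit.unit)
    have hs : (F.obj j).hom y = s :=
      (ConcreteCategory.congr_hom (Over.w (c.ι.app j)) y).symm.trans
        ((congrArg _ hy).trans (ConcreteCategory.congr_hom (Over.w f) PUnit.unit))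
    refine ⟨j, Over.homMk (TypeCat.ofHom fun _ => y) (by ext; exact hs), ?_⟩
    refine Over.OverMorphism.ext ?_
    ext ⟨⟩
    exact hy.symm
  · obtain ⟨k, a, b, hab⟩ := (Types.FilteredColimit.isColimit_eq_iff _ hc').1
      (congrArg (fun t : point s ⟶ c.pt => t.left PUnit.unit) h)
    refine ⟨k, a, b, ?_⟩
    refine Over.OverMorphism.ext ?_
    ext ⟨⟩
    exact hab

attribute [local instance] Cardinal.fact_isRegular_aleph0

theorem freeOnPoint_le_isCardinalPresentable :
    freeOnPoint.{u} ≤ isCardinalPresentable ActionOperad.{u} Cardinal.aleph0.{u} := by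
  rintro _ ⟨s⟩
  have : forget.{u}.IsCardinalAccessible Cardinal.aleph0.{u} :=
    Functor.isFinitelyAccessible_iff_preservesFilteredColimits.2 inferInstance
  have := isFinitelyPresentable_point s
  exact freeAdjunction.isCardinalPresentable_leftAdjoint_obj Cardinal.aleph0.{u} (point s)

theorem isLocallyFinitelyPresentable : IsLocallyFinitelyPresentable.{u} ActionOperad.{u} :=
  (IsCardinalLocallyPresentable.iff_exists_isStrongGenerator _ _).2
    ⟨freeOnPoint, inferInstance, freeOnPoint_isStrongGenerator,
      freeOnPoint_le_isCardinalPresentable⟩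

end ActionOperad

theorem mainTheorem8 :
    IsLocallyFinitelyPresentable.{u} ActionOperad.{u} ∧
    PreservesLimits ActionOperad.forget.{u} ∧
    PreservesFilteredColimits ActionOperad.forget.{u} ∧
    ∃ F : SymmCollection.{u} ⥤ ActionOperad.{u}, Nonempty (F ⊣ ActionOperad.forget.{u}) :=
  ⟨ActionOperad.isLocallyFinitelyPresentable,
    ActionOperad.freeAdjunction.rightAdjoint_preservesLimits, inferInstance,
    ActionOperad.freeFunctor, ⟨ActionOperad.freeAdjunction⟩⟩
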